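/- Let $\Omega\subset\mathbb R^2$ be open with coordinates $x,y$ and metric $h=e^{2u}(dx^2+dy^2)$, $u\in C^\infty(\Omega,\mathbb R)$ (that is, $\Omega$ is a domain in a Riemannian surface described in isothermal coordinates), and let $e_1=e^{-u}\partial_x$, $e_2=e^{-u}\partial_y$. In the spin frame over $(e_1,e_2)$ spinors are $\mathbb C^2$-valued functions with the Hermitian product $\langle\cdot,\cdot\rangle$ (conjugate-linear in the first, linear in the second argument); Clifford multiplication by $e_1,e_2$ is given by constant skew-Hermitian endomorphisms with $e_\alpha\cdot e_\beta\cdot+e_\beta\cdot e_\alpha\cdot=-2\delta_{\alpha\beta}$, one has $\partial_x\cdot=e^{u}e_1\cdot$ and $\partial_y\cdot=e^ue_2\cdot$, the spinor connection is $\nabla_{X}\psi=X(\psi)+\tfrac12h(\nabla_Xe_1,e_2)\,e_1\cdot e_2\cdot\psi$, and the Dirac operator is $\slashed\partial=\sum_\alpha e_\alpha\cdot\nabla_{e_\alpha}$. Let $\kappa\in\mathbb R$, and sum over repeated indices. Let $(\phi,\psi)$ be a smooth $\kappa$-Dirac-harmonic map from $\Omega$ to $S^n\subset\mathbb R^{n+1}$: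 $\phi\colon\Omega\to S^n$ is smooth, $\psi=(\psi^1,\dots,\psi^{n+1})$ is a tuple of smooth spinors with $\phi^i\psi^i=0$, and for $i=1,\dots,n+1$, with $\phi^j_\alpha=d\phi^j(e_\alpha)$, $|\psi|^2=\sum_j|\psi^j|^2$ and $\Delta$ the Laplace-Beltrami operator, $$-\Delta\phi^i=|d\phi|^2\phi^i+\operatorname{Re}\langle\psi^i,e_\alpha\cdot\psi^j\rangle\,\phi^j_\alpha,\qquad \slashed\partial\psi^i=-\phi^i\,\phi^j_\alpha\, e_\alpha\cdot\psi^j-2\kappa\big(|\psi|^2\psi^i-\langle\psi^j,\psi^i\rangle\psi^j\big).$$ Define the Noether current, for $\alpha\in\{x,y\}$, by $$J_\alpha^{im}=\operatorname{Re}\langle\partial_\alpha\cdot\psi^i,\psi^m\rangle+(\partial_\alpha\phi^i)\,\phi^m-\phi^i\,\partial_\alpha\phi^m .$$ Then on $\Omega$, for all $i,m\in\{1,\dots,n+1\}$, $$\begin{aligned} \partial_xJ_y^{im}&-\partial_yJ_x^{im}-2\big(J_x^{ij}J_y^{jm}-J_y^{ij}J_x^{jm}\big) =-\partial_x\operatorname{Re}\langle\partial_y\cdot\psi^i,\psi^m\rangle+\partial_y\operatorname{Re}\langle\partial_x\cdot\psi^i,\psi^m\rangle\\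 &-2\big(\operatorname{Re}\langle\psi^i,\partial_x\cdot\psi^j\rangle\operatorname{Re}\langle\psi^j,\partial_y\cdot\psi^m\rangle-\operatorname{Re}\langle\psi^i,\partial_y\cdot\psi^j\rangle\operatorname{Re}\langle\psi^j,\partial_x\cdot\psi^m\rangle\big)\\ &+4\kappa\operatorname{Re}\big(2|\psi|^2\langle\psi^i,\partial_x\cdot\partial_y\cdot\psi^m\rangle+\langle\psi^i,\psi^j\rangle\langle\partial_x\cdot\partial_y\cdot\psi^j,\psi^m\rangle-\langle\psi^i,\partial_x\cdot\partial_y\cdot\psi^j\rangle\langle\psi^j,\psi^m\rangle\big). \end{aligned}$$ -/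

import Mathlib

open scoped ContDiff

noncomputable section

namespace DiracHarmonic

/-- The coordinate plane; the coordinates are `x = x⁰` and `y = x¹`. -/
abbrev Plane : Type := EuclideanSpace ℝ (Fin 2)

/-- The fibre of the spinor bundle of a surface in a spin frame, with its standard Hermitian product
`inner ℂ`, which is conjugate-linear in the first and linear in the second argument. -/
abbrev Spinor : Type := EuclideanSpace ℂ (Fin 2)

/-- The partial derivative `∂_α f`. -/
def pd {E : Type*} [NormedAddCommGroup E] [NormedSpace ℝ E]
    (α : Fin 2) (f : Plane → E) (p : Plane) : E :=
  fderiv ℝ f p (EuclideanSpace.single α 1)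

/-- Clifford multiplication by an orthonormal frame `e₀, e₁`: skew-Hermitian endomorphisms of the
spinor space that satisfy the Clifford relations `e_α e_β + e_β e_α = -2 δ_{αβ}`. -/
structure CliffordMul where
  e : Fin 2 → Spinor →ₗ[ℂ] Spinor
  skew : ∀ (α : Fin 2) (ψ η : Spinor), inner ℂ ψ (e α η) = -inner ℂ (e α ψ) η
  relation : ∀ (α β : Fin 2) (ψ : Spinor),
    e α (e β ψ) + e β (e α ψ) = if α = β then (-2 : ℂ) • ψ else 0

/- Throughout, `u` is the logarithm of the conformal factor: in the isothermal coordinates `x, y` the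
metric is `h = exp (2 u) (dx² + dy²)`, and `e_α = exp (-u) ∂_α` is an orthonormal frame. -/

/-- Clifford multiplication `∂_α · η` by the coordinate vector field `∂_α = exp u • e_α`. -/
def coordMul (γ : CliffordMul) (u : Plane → ℝ) (α : Fin 2) (p : Plane) (η : Spinor) : Spinor :=
  Real.exp (u p) • γ.e α η

/-- The Levi-Civita connection form `h(∇_{∂_α} e₀, e₁)` of `h` in the frame `e_α`: it equals
`-∂_y u` for `∂_x` and `∂_x u` for `∂_y`. -/
def connForm (u : Plane → ℝ) (α : Fin 2) (p : Plane) : ℝ :=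
  if α = 0 then -pd 1 u p else pd 0 u p

/-- The spinor connection
`∇_{∂_α} ψ = ∂_α ψ + ½ h(∇_{∂_α} e₀, e₁) e₀ · e₁ · ψ` in the spin frame over `e_α`. -/
def spinConn (γ : CliffordMul) (u : Plane → ℝ) (α : Fin 2) (ψ : Plane → Spinor) (p : Plane) :
    Spinor :=
  pd α ψ p + (1 / 2 * connForm u α p) • γ.e 0 (γ.e 1 (ψ p))

/-- The Dirac operator `e_α · ∇_{e_α} ψ`. -/
def dirac (γ : CliffordMul) (u : Plane → ℝ) (ψ : Plane → Spinor) (p : Plane) : Spinor :=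
  ∑ α, γ.e α (Real.exp (-u p) • spinConn γ u α ψ p)

/-- The Laplace-Beltrami operator of `h`. -/
def laplace (u : Plane → ℝ) (f : Plane → ℝ) (p : Plane) : ℝ :=
  Real.exp (-2 * u p) * ∑ α, pd α (pd α f) p

/-- The derivative `df(e_α)` in the direction of the orthonormal frame. -/
def frameDeriv (u : Plane → ℝ) (α : Fin 2) (f : Plane → ℝ) (p : Plane) : ℝ :=
  Real.exp (-u p) * pd α f p

variable {n : ℕ}

/-- The squared norm `|ψ|²` of a vector spinor. -/
def normSqSpinor (ψ : Fin (n + 1) → Plane → Spinor) (p : Plane) : ℝ :=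
  ∑ j, ‖ψ j p‖ ^ 2

/-- `(φ, ψ)` is a smooth `κ`-Dirac-harmonic map from the coordinate domain `Ω`, with the metric
`exp (2 u) (dx² + dy²)`, to the round sphere `Sⁿ ⊂ ℝⁿ⁺¹`. The vector spinor `ψ` along `φ` is given by
its components `ψⁱ`, and `∑ φⁱ ψⁱ = 0` says that it takes values in the tangent spaces of `Sⁿ`. -/
structure IsKappaDiracHarmonic (γ : CliffordMul) (Ω : Set Plane) (u : Plane → ℝ) (κ : ℝ)
    (φ : Plane → EuclideanSpace ℝ (Fin (n + 1))) (ψ : Fin (n + 1) → Plane → Spinor) : Prop where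
  smooth_map : ContDiffOn ℝ ∞ φ Ω
  smooth_spinor : ∀ i, ContDiffOn ℝ ∞ (ψ i) Ω
  mem_sphere : ∀ p ∈ Ω, φ p ∈ Metric.sphere (0 : EuclideanSpace ℝ (Fin (n + 1))) 1
  tangent : ∀ p ∈ Ω, ∑ i, φ p i • ψ i p = 0
  map_eq : ∀ p ∈ Ω, ∀ i,
    -laplace u (fun q => φ q i) p =
      (∑ α, ∑ j, frameDeriv u α (fun q => φ q j) p ^ 2) * φ p i
        + ∑ α, ∑ j, (inner ℂ (ψ i p) (γ.e α (ψ j p))).re * frameDeriv u α (fun q => φ q j) p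
  spinor_eq : ∀ p ∈ Ω, ∀ i,
    dirac γ u (ψ i) p =
      -(φ p i • ∑ α, ∑ j, frameDeriv u α (fun q => φ q j) p • γ.e α (ψ j p))
        - (2 * κ) • (normSqSpinor ψ p • ψ i p - ∑ j, inner ℂ (ψ j p) (ψ i p) • ψ j p)

/-- The Noether current
`J_α^{im} = Re ⟨∂_α · ψⁱ, ψᵐ⟩ + (∂_α φⁱ φᵐ - φⁱ ∂_α φᵐ)` in the direction `∂_α`. -/
def current (γ : CliffordMul) (u : Plane → ℝ)
    (φ : Plane → EuclideanSpace ℝ (Fin (n + 1))) (ψ : Fin (n + 1) → Plane → Spinor)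
    (α : Fin 2) (i m : Fin (n + 1)) (p : Plane) : ℝ :=
  (inner ℂ (coordMul γ u α p (ψ i p)) (ψ m p)).re
    + (pd α (fun q => φ q i) p * φ p m - φ p i * pd α (fun q => φ q m) p)

end DiracHarmonic

end

open scoped ContDiff

namespace DiracHarmonic

/-! ### Coordinate derivatives of real functions. -/

section Calculus

variable {f g : Plane → ℝ} {p : Plane}

/-! Write J = S + W with S the spinorial part and W the Wronskian of φ. Since |φ| = 1, φ is
orthogonal to its derivatives, and tangency of ψ makes S annihilate φ. Hence (`sum_commutator`)
[J_x, J_y] = [S_x, S_y] + A + B, where A collects the mixed terms φ·dφ·S and B = ∂_yφⁱ ∂_xφᵐ - ∂_xφⁱ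
∂_yφᵐ. By symmetry of second derivatives curl W = 2B (`curl_wronskian`), so B drops out of curl J -
2[J_x, J_y]. For S, let ω = e₀e₁. Then ω times the Dirac operator is a curl of Clifford
multiplication (`volume_dirac`), so the spinor equation gives curl S = A + 2κK, with K the quartic
term (`curl_spinor_current`). What remains is curl S - 2A - 2[S_x, S_y] = -curl S - 2[S_x, S_y] +
4κK. Eliminating A in this way reverses the sign of curl S and doubles the factor 2κ. -/

theorem pd_add (hf : DifferentiableAt ℝ f p) (hg : DifferentiableAt ℝ g p) (α : Fin 2) :
    pd α (fun q => f q + g q) p = pd α f p + pd α g p := by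
  simp only [pd]
  rw [fderiv_fun_add hf hg]
  rfl

theorem pd_sub (hf : DifferentiableAt ℝ f p) (hg : DifferentiableAt ℝ g p) (α : Fin 2) :
    pd α (fun q => f q - g q) p = pd α f p - pd α g p := by
  simp only [pd]
  rw [fderiv_fun_sub hf hg]
  rfl

theorem pd_mul (hf : DifferentiableAt ℝ f p) (hg : DifferentiableAt ℝ g p) (α : Fin 2) :
    pd α (fun q => f q * g q) p = pd α f p * g p + f p * pd α g p := by
  simp only [pd]
  rw [fderiv_fun_mul hf hg]
  simp only [add_apply, smul_apply, smul_eq_mul]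
  ring

theorem pd_exp (hf : DifferentiableAt ℝ f p) (α : Fin 2) :
    pd α (fun q => Real.exp (f q)) p = Real.exp (f p) * pd α f p := by
  simp only [pd]
  rw [fderiv_exp hf]
  rfl

theorem differentiableAt_pd (hf : ContDiffAt ℝ ∞ f p) (α : Fin 2) :
    DifferentiableAt ℝ (pd α f) p := by
  have h : ContDiffAt ℝ 1 (fderiv ℝ f) p := hf.fderiv_right (m := 1) (by norm_cast)
  exact (h.differentiableAt (by norm_num)).clm_apply (differentiableAt_const _)

theorem pd_comm (hf : ContDiffAt ℝ ∞ f p) (α β : Fin 2) :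
    pd α (pd β f) p = pd β (pd α f) p := by
  have h : ContDiffAt ℝ 1 (fderiv ℝ f) p := hf.fderiv_right (m := 1) (by norm_cast)
  have hd : DifferentiableAt ℝ (fderiv ℝ f) p := h.differentiableAt (by norm_num)
  have hs : IsSymmSndFDerivAt ℝ f p := hf.isSymmSndFDerivAt (by
    simp only [minSmoothness_of_isRCLikeNormedField]
    exact WithTop.coe_le_coe.2 le_top)
  have key : ∀ α β : Fin 2, pd α (pd β f) p =
      fderiv ℝ (fderiv ℝ f) p (EuclideanSpace.single α 1) (EuclideanSpace.single β 1) := by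
    intro α β
    have : HasFDerivAt (pd β f) _ p :=
      hd.hasFDerivAt.clm_apply (hasFDerivAt_const (EuclideanSpace.single β (1 : ℝ)) p)
    rw [pd, this.fderiv]
    simp
  rw [key, key, hs.eq]

end Calculus

variable {n : ℕ}

/-! ### Clifford multiplication and the Dirac operator. -/

section Spinors

variable (γ : CliffordMul) {u : Plane → ℝ} {ψ η : Plane → Spinor} {p : Plane}

theorem hasFDerivAt_cliffordMul (hψ : DifferentiableAt ℝ ψ p) (α : Fin 2) :
    HasFDerivAt (fun q => γ.e α (ψ q))
      (((γ.e α).toContinuousLinearMap.restrictScalars ℝ).comp (fderiv ℝ ψ p)) p :=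
  ((γ.e α).toContinuousLinearMap.restrictScalars ℝ).hasFDerivAt.comp p hψ.hasFDerivAt

theorem hasFDerivAt_bilinear (hψ : DifferentiableAt ℝ ψ p) (hη : DifferentiableAt ℝ η p)
    (α : Fin 2) :
    ∃ L : Plane →L[ℝ] ℝ, HasFDerivAt (fun q => (inner ℂ (γ.e α (ψ q)) (η q)).re) L p ∧
      ∀ v, L v = (inner ℂ (γ.e α (fderiv ℝ ψ p v)) (η p)).re
        + (inner ℂ (γ.e α (ψ p)) (fderiv ℝ η p v)).re := by
  refine ⟨_, Complex.reCLM.hasFDerivAt.comp p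
    ((hasFDerivAt_cliffordMul γ hψ α).inner ℂ hη.hasFDerivAt), fun v => ?_⟩
  simp [fderivInnerCLM_apply, add_comm]

theorem re_inner_coordMul_left (u : Plane → ℝ) (α : Fin 2) (q : Plane) (a b : Spinor) :
    (inner ℂ (coordMul γ u α q a) b).re = Real.exp (u q) * (inner ℂ (γ.e α a) b).re := by
  rw [coordMul, ← Complex.coe_smul, inner_smul_left, Complex.conj_ofReal, Complex.re_ofReal_mul]

theorem differentiableAt_re_inner_coordMul (hu : DifferentiableAt ℝ u p)
    (hψ : DifferentiableAt ℝ ψ p) (hη : DifferentiableAt ℝ η p) (α : Fin 2) :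
    DifferentiableAt ℝ (fun q => (inner ℂ (coordMul γ u α q (ψ q)) (η q)).re) p := by
  obtain ⟨L, hL, -⟩ := hasFDerivAt_bilinear γ hψ hη α
  simp only [re_inner_coordMul_left]
  exact hu.exp.mul hL.differentiableAt

theorem pd_re_inner_coordMul (hu : DifferentiableAt ℝ u p)
    (hψ : DifferentiableAt ℝ ψ p) (hη : DifferentiableAt ℝ η p) (α β : Fin 2) :
    pd β (fun q => (inner ℂ (coordMul γ u α q (ψ q)) (η q)).re) p =
      Real.exp (u p) * (pd β u p * (inner ℂ (γ.e α (ψ p)) (η p)).re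
        + (inner ℂ (γ.e α (pd β ψ p)) (η p)).re + (inner ℂ (γ.e α (ψ p)) (pd β η p)).re) := by
  obtain ⟨L, hL, hLv⟩ := hasFDerivAt_bilinear γ hψ hη α
  simp only [re_inner_coordMul_left]
  rw [pd_mul hu.exp hL.differentiableAt, pd_exp hu]
  simp only [pd]
  rw [hL.fderiv, hLv]
  ring

theorem CliffordMul.sq (α : Fin 2) (a : Spinor) : γ.e α (γ.e α a) = -a := by
  have h := γ.relation α α a
  rw [if_pos rfl, ← two_smul ℂ, neg_smul, ← smul_neg] at h
  exact smul_right_injective _ (two_ne_zero (α := ℂ)) h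

theorem CliffordMul.anticomm (a : Spinor) : γ.e 1 (γ.e 0 a) = -γ.e 0 (γ.e 1 a) := by
  have h := γ.relation 1 0 a
  rw [if_neg (by decide)] at h
  exact eq_neg_of_add_eq_zero_left h

theorem CliffordMul.map_real_smul (α : Fin 2) (r : ℝ) (a : Spinor) :
    γ.e α (r • a) = r • γ.e α a := by
  rw [← Complex.coe_smul, map_smul, Complex.coe_smul]

/-- The volume element turns the Dirac operator into the curl of Clifford multiplication. -/
theorem volume_dirac (u : Plane → ℝ) (ψ : Plane → Spinor) (p : Plane) :
    γ.e 0 (γ.e 1 (dirac γ u ψ p)) = Real.exp (-u p) • (γ.e 1 (pd 0 ψ p) - γ.e 0 (pd 1 ψ p)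
      + (1 / 2 * pd 0 u p) • γ.e 1 (ψ p) - (1 / 2 * pd 1 u p) • γ.e 0 (ψ p)) := by
  -- With ω = e₀e₁ one has ωe₀ = e₁, ωe₁ = -e₀ and ωe_αω = e_α; the last identity handles the
  -- connection term.
  simp only [dirac, spinConn, connForm, Fin.sum_univ_two, map_add, γ.map_real_smul, γ.sq,
    γ.anticomm, map_neg, if_true, one_ne_zero, if_false]
  module

/-- The curl of the spinorial part of the Noether current in terms of the Dirac operator. -/
theorem curl_re_inner_coordMul (hu : DifferentiableAt ℝ u p)
    (hψ : DifferentiableAt ℝ ψ p) (hη : DifferentiableAt ℝ η p) :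
    pd 0 (fun q => (inner ℂ (coordMul γ u 1 q (ψ q)) (η q)).re) p
        - pd 1 (fun q => (inner ℂ (coordMul γ u 0 q (ψ q)) (η q)).re) p =
      Real.exp (u p) ^ 2 * ((inner ℂ (γ.e 0 (γ.e 1 (dirac γ u ψ p))) (η p)).re
        - (inner ℂ (ψ p) (γ.e 0 (γ.e 1 (dirac γ u η p)))).re) := by
  -- Each Dirac term contributes half of du from the spin connection; together they match the
  -- derivative of the conformal factor exp u.
  rw [pd_re_inner_coordMul γ hu hψ hη, pd_re_inner_coordMul γ hu hψ hη, volume_dirac, volume_dirac]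
  simp only [← Complex.coe_smul (E := Spinor), inner_smul_left, inner_smul_right, inner_add_left,
    inner_add_right, inner_sub_left, inner_sub_right, Complex.conj_ofReal, Complex.re_ofReal_mul,
    Complex.add_re, Complex.sub_re, Complex.neg_re, γ.skew]
  rw [Real.exp_neg]
  field_simp
  ring

end Spinors

/-! ### Sphere-valued maps and Wronskians. -/

section Maps

variable {φ : Plane → EuclideanSpace ℝ (Fin (n + 1))} {p : Plane}

theorem contDiffAt_coord (hφ : ContDiffAt ℝ ∞ φ p) (j : Fin (n + 1)) :
    ContDiffAt ℝ ∞ (fun q => φ q j) p :=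
  contDiffAt_euclidean.1 hφ j

/-- A map into the unit sphere is orthogonal to its derivatives. -/
theorem sum_mul_pd_eq_zero {Ω : Set Plane} (hΩ : IsOpen Ω) (hp : p ∈ Ω)
    (hφ : ContDiffAt ℝ ∞ φ p)
    (hs : ∀ q ∈ Ω, φ q ∈ Metric.sphere (0 : EuclideanSpace ℝ (Fin (n + 1))) 1) (α : Fin 2) :
    ∑ j, φ p j * pd α (fun q => φ q j) p = 0 := by
  have hd : ∀ j, DifferentiableAt ℝ (fun q => φ q j) p := fun j =>
    (contDiffAt_coord hφ j).differentiableAt (by simp)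
  have hone : (fun q => ∑ j, φ q j * φ q j) =ᶠ[nhds p] fun _ => 1 := by
    filter_upwards [hΩ.mem_nhds hp] with q hq
    have h := EuclideanSpace.real_norm_sq_eq (φ q)
    rw [mem_sphere_zero_iff_norm.1 (hs q hq)] at h
    simpa [sq] using h.symm
  have hz : pd α (fun q => ∑ j, φ q j * φ q j) p = 0 := by
    rw [pd, hone.fderiv_eq]
    simp
  have hsum : pd α (fun q => ∑ j, φ q j * φ q j) p
      = ∑ j, pd α (fun q => φ q j * φ q j) p := by
    simp only [pd]
    rw [fderiv_fun_sum fun j _ => (hd j).fun_mul (hd j)]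
    simp
  rw [hsum] at hz
  simp only [fun j => pd_mul (hd j) (hd j) α] at hz
  have h2 : ∑ j, (pd α (fun q => φ q j) p * φ p j + φ p j * pd α (fun q => φ q j) p)
      = 2 * ∑ j, φ p j * pd α (fun q => φ q j) p := by
    rw [Finset.mul_sum]
    exact Finset.sum_congr rfl fun j _ => by ring
  linarith

variable {f g : Plane → ℝ}

theorem differentiableAt_wronskian (hf : ContDiffAt ℝ ∞ f p) (hg : ContDiffAt ℝ ∞ g p)
    (α : Fin 2) : DifferentiableAt ℝ (fun q => pd α f q * g q - f q * pd α g q) p :=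
  ((differentiableAt_pd hf α).mul (hg.differentiableAt (by simp))).sub
    ((hf.differentiableAt (by simp)).mul (differentiableAt_pd hg α))

theorem pd_wronskian (hf : ContDiffAt ℝ ∞ f p) (hg : ContDiffAt ℝ ∞ g p) (α β : Fin 2) :
    pd β (fun q => pd α f q * g q - f q * pd α g q) p =
      pd β (pd α f) p * g p + pd α f p * pd β g p
        - (pd β f p * pd α g p + f p * pd β (pd α g) p) := by
  have hf' := hf.differentiableAt (by simp)
  have hg' := hg.differentiableAt (by simp)
  rw [pd_sub ((differentiableAt_pd hf α).fun_mul hg') (hf'.fun_mul (differentiableAt_pd hg α)),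
    pd_mul (differentiableAt_pd hf α) hg', pd_mul hf' (differentiableAt_pd hg α)]

/-- Mixed second derivatives cancel by symmetry, leaving only products of first derivatives. -/
theorem curl_wronskian (hf : ContDiffAt ℝ ∞ f p) (hg : ContDiffAt ℝ ∞ g p) :
    pd 0 (fun q => pd 1 f q * g q - f q * pd 1 g q) p
        - pd 1 (fun q => pd 0 f q * g q - f q * pd 0 g q) p =
      2 * (pd 1 f p * pd 0 g p - pd 0 f p * pd 1 g p) := by
  rw [pd_wronskian hf hg, pd_wronskian hf hg, pd_comm hf 0 1, pd_comm hg 0 1]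
  ring

end Maps

/-- The commutator of two skew forms `s + (b ⊗ a - a ⊗ b)` and `t + (c ⊗ a - a ⊗ c)`, where `a` is a
unit vector that is orthogonal to `b`, `c` and annihilated by `s`, `t`. -/
theorem sum_commutator {ι : Type*} [Fintype ι] (a b c : ι → ℝ) (s t : ι → ι → ℝ)
    (haa : ∑ j, a j * a j = 1) (hab : ∑ j, a j * b j = 0) (hac : ∑ j, a j * c j = 0)
    (hs : ∀ i, ∑ j, s i j * a j = 0) (hs' : ∀ i, ∑ j, a j * s j i = 0)
    (ht : ∀ i, ∑ j, t i j * a j = 0) (ht' : ∀ i, ∑ j, a j * t j i = 0) (i m : ι) :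
    ∑ j, ((s i j + (b i * a j - a i * b j)) * (t j m + (c j * a m - a j * c m))
        - (t i j + (c i * a j - a i * c j)) * (s j m + (b j * a m - a j * b m))) =
      ∑ j, (s i j * t j m - t i j * s j m)
        + a m * ∑ j, (c j * s i j - b j * t i j) - a i * ∑ j, (b j * t j m - c j * s j m)
        + (c i * b m - b i * c m) := by
  -- The summand is sorted by its contractions over j; of those involving a, only a·a = 1 survives.
  calc _ = ∑ j, ((s i j * t j m - t i j * s j m) + a m * (c j * s i j - b j * t i j)
        + (-a i) * (b j * t j m - c j * s j m)
        + (-c m) * (s i j * a j) + b m * (t i j * a j) + b i * (a j * t j m)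
        + (-c i) * (a j * s j m) + (b i * a m - a i * b m) * (a j * c j)
        + (a i * c m - c i * a m) * (a j * b j) + (c i * b m - b i * c m) * (a j * a j)) :=
        Finset.sum_congr rfl fun j _ => by ring
    _ = _ := by
      simp only [Finset.sum_add_distrib, ← Finset.mul_sum, haa, hab, hac, hs, hs', ht, ht']
      ring

/-! ### Consequences of the spinor equation. -/

namespace IsKappaDiracHarmonic

variable {γ : CliffordMul} {Ω : Set Plane} {u : Plane → ℝ} {κ : ℝ}
  {φ : Plane → EuclideanSpace ℝ (Fin (n + 1))} {ψ : Fin (n + 1) → Plane → Spinor} {p : Plane}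

theorem volume_dirac_eq (h : IsKappaDiracHarmonic γ Ω u κ φ ψ) (hp : p ∈ Ω) (i : Fin (n + 1)) :
    γ.e 0 (γ.e 1 (dirac γ u (ψ i) p)) =
      -((φ p i * Real.exp (-u p)) • ∑ j, (pd 0 (fun q => φ q j) p • γ.e 1 (ψ j p)
          - pd 1 (fun q => φ q j) p • γ.e 0 (ψ j p)))
        - (2 * κ) • (normSqSpinor ψ p • γ.e 0 (γ.e 1 (ψ i p))
          - ∑ j, inner ℂ (ψ j p) (ψ i p) • γ.e 0 (γ.e 1 (ψ j p))) := by
  rw [h.spinor_eq p hp i]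
  simp only [frameDeriv, Fin.sum_univ_two, map_sub, map_neg, map_add, map_sum, map_smul,
    γ.map_real_smul, γ.sq, γ.anticomm, neg_neg, ← smul_smul, smul_neg, Finset.sum_neg_distrib,
    Finset.sum_sub_distrib, ← Finset.smul_sum]
  module

/-- Conjugate-linearity in the first slot turns the coefficient ⟨ψʲ, ψⁱ⟩ into ⟨ψⁱ, ψʲ⟩. -/
theorem re_inner_volume_dirac_left (h : IsKappaDiracHarmonic γ Ω u κ φ ψ) (hp : p ∈ Ω)
    (i m : Fin (n + 1)) :
    (inner ℂ (γ.e 0 (γ.e 1 (dirac γ u (ψ i) p))) (ψ m p)).re =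
      -(φ p i * Real.exp (-u p) * ∑ j,
          (pd 0 (fun q => φ q j) p * (inner ℂ (γ.e 1 (ψ j p)) (ψ m p)).re
            - pd 1 (fun q => φ q j) p * (inner ℂ (γ.e 0 (ψ j p)) (ψ m p)).re))
        - 2 * κ * (normSqSpinor ψ p * (inner ℂ (γ.e 0 (γ.e 1 (ψ i p))) (ψ m p)).re
          - ∑ j, (inner ℂ (ψ i p) (ψ j p) * inner ℂ (γ.e 0 (γ.e 1 (ψ j p))) (ψ m p)).re) := by
  rw [h.volume_dirac_eq hp i]
  simp only [← Complex.coe_smul (E := Spinor), inner_sub_left, inner_neg_left, inner_smul_left,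
    sum_inner, Complex.conj_ofReal, inner_conj_symm, Complex.sub_re, Complex.neg_re,
    Complex.re_ofReal_mul, Complex.re_sum]

theorem re_inner_volume_dirac_right (h : IsKappaDiracHarmonic γ Ω u κ φ ψ) (hp : p ∈ Ω)
    (i m : Fin (n + 1)) :
    (inner ℂ (ψ i p) (γ.e 0 (γ.e 1 (dirac γ u (ψ m) p)))).re =
      (φ p m * Real.exp (-u p) * ∑ j,
          (pd 0 (fun q => φ q j) p * (inner ℂ (γ.e 1 (ψ i p)) (ψ j p)).re
            - pd 1 (fun q => φ q j) p * (inner ℂ (γ.e 0 (ψ i p)) (ψ j p)).re))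
        - 2 * κ * (normSqSpinor ψ p * (inner ℂ (ψ i p) (γ.e 0 (γ.e 1 (ψ m p)))).re
          - ∑ j, (inner ℂ (ψ i p) (γ.e 0 (γ.e 1 (ψ j p))) * inner ℂ (ψ j p) (ψ m p)).re) := by
  have hneg : ∀ j, pd 0 (fun q => φ q j) p * (inner ℂ (γ.e 1 (ψ i p)) (ψ j p)).re
      - pd 1 (fun q => φ q j) p * (inner ℂ (γ.e 0 (ψ i p)) (ψ j p)).re
      = -(pd 0 (fun q => φ q j) p * (inner ℂ (ψ i p) (γ.e 1 (ψ j p))).re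
        - pd 1 (fun q => φ q j) p * (inner ℂ (ψ i p) (γ.e 0 (ψ j p))).re) := by
    intro j
    simp only [γ.skew, Complex.neg_re]
    ring
  rw [h.volume_dirac_eq hp m, Finset.sum_congr rfl fun j _ => hneg j, Finset.sum_neg_distrib]
  rw [Finset.sum_congr rfl fun j _ => congrArg Complex.re
    (mul_comm (inner ℂ (ψ i p) (γ.e 0 (γ.e 1 (ψ j p)))) (inner ℂ (ψ j p) (ψ m p)))]
  simp only [← Complex.coe_smul (E := Spinor), inner_sub_right, inner_neg_right, inner_smul_right,
    inner_sum, Complex.sub_re, Complex.neg_re, Complex.re_ofReal_mul, Complex.re_sum, mul_neg]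

/-- Tangency of ψ paired with a fixed spinor: this is why the spinorial current annihilates φ. -/
theorem sum_re_inner_mul_eq_zero (h : IsKappaDiracHarmonic γ Ω u κ φ ψ) (hp : p ∈ Ω)
    (a : Spinor) : ∑ j, (inner ℂ a (ψ j p)).re * φ p j = 0 := by
  have h0 := congrArg (fun b => (inner ℂ a b).re) (h.tangent p hp)
  simp only [← Complex.coe_smul (E := Spinor), inner_sum, inner_smul_right, Complex.re_sum,
    Complex.re_ofReal_mul, inner_zero_right, Complex.zero_re] at h0
  simpa only [mul_comm] using h0

/-- The curl of the spinorial part of the Noether current of a `κ`-Dirac-harmonic map. -/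
theorem curl_spinor_current (h : IsKappaDiracHarmonic γ Ω u κ φ ψ) (hΩ : IsOpen Ω) (hp : p ∈ Ω)
    (hu : DifferentiableAt ℝ u p) (i m : Fin (n + 1)) :
    pd 0 (fun q => (inner ℂ (coordMul γ u 1 q (ψ i q)) (ψ m q)).re) p
        - pd 1 (fun q => (inner ℂ (coordMul γ u 0 q (ψ i q)) (ψ m q)).re) p =
      -(φ p i * ∑ j, (pd 0 (fun q => φ q j) p * (inner ℂ (coordMul γ u 1 p (ψ j p)) (ψ m p)).re
          - pd 1 (fun q => φ q j) p * (inner ℂ (coordMul γ u 0 p (ψ j p)) (ψ m p)).re))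
        - φ p m * ∑ j, (pd 0 (fun q => φ q j) p * (inner ℂ (coordMul γ u 1 p (ψ i p)) (ψ j p)).re
          - pd 1 (fun q => φ q j) p * (inner ℂ (coordMul γ u 0 p (ψ i p)) (ψ j p)).re)
        + 2 * κ *
          (2 * (normSqSpinor ψ p : ℂ)
                * inner ℂ (ψ i p) (coordMul γ u 0 p (coordMul γ u 1 p (ψ m p)))
            + ∑ j, (inner ℂ (ψ i p) (ψ j p)
                  * inner ℂ (coordMul γ u 0 p (coordMul γ u 1 p (ψ j p))) (ψ m p)
                - inner ℂ (ψ i p) (coordMul γ u 0 p (coordMul γ u 1 p (ψ j p)))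
                  * inner ℂ (ψ j p) (ψ m p))).re := by
  have hψ : ∀ j, DifferentiableAt ℝ (ψ j) p := fun j =>
    ((h.smooth_spinor j).contDiffAt (hΩ.mem_nhds hp)).differentiableAt (by simp)
  have hvol : ∀ j, coordMul γ u 0 p (coordMul γ u 1 p (ψ j p))
      = ((Real.exp (u p) ^ 2 : ℝ) : ℂ) • γ.e 0 (γ.e 1 (ψ j p)) := by
    intro j
    rw [Complex.coe_smul, sq, mul_smul, coordMul, coordMul, γ.map_real_smul]
  have hsum : ∀ (c : ℝ) (f : Fin (n + 1) → ℝ) (g : Fin (n + 1) → ℝ) (f' g' : Fin (n + 1) → ℝ),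
      ∑ j, (f j * (c * f' j) - g j * (c * g' j)) = c * ∑ j, (f j * f' j - g j * g' j) := by
    intro c f g f' g'
    rw [Finset.mul_sum]
    exact Finset.sum_congr rfl fun j _ => by ring
  have hκ : (2 * (normSqSpinor ψ p : ℂ)
                * inner ℂ (ψ i p) (coordMul γ u 0 p (coordMul γ u 1 p (ψ m p)))
            + ∑ j, (inner ℂ (ψ i p) (ψ j p)
                  * inner ℂ (coordMul γ u 0 p (coordMul γ u 1 p (ψ j p))) (ψ m p)
                - inner ℂ (ψ i p) (coordMul γ u 0 p (coordMul γ u 1 p (ψ j p)))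
                  * inner ℂ (ψ j p) (ψ m p))).re =
      Real.exp (u p) ^ 2 *
        (2 * normSqSpinor ψ p * (inner ℂ (ψ i p) (γ.e 0 (γ.e 1 (ψ m p)))).re
          + (∑ j, (inner ℂ (ψ i p) (ψ j p) * inner ℂ (γ.e 0 (γ.e 1 (ψ j p))) (ψ m p)).re
          - ∑ j, (inner ℂ (ψ i p) (γ.e 0 (γ.e 1 (ψ j p))) * inner ℂ (ψ j p) (ψ m p)).re)) := by
    simp only [hvol, inner_smul_left, inner_smul_right, Complex.conj_ofReal]
    rw [← Finset.sum_sub_distrib, mul_add, Finset.mul_sum, Complex.add_re, Complex.re_sum]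
    congr 1
    · rw [← Complex.re_ofReal_mul, ← Complex.re_ofReal_mul]
      congr 1
      push_cast
      ring
    · refine Finset.sum_congr rfl fun j _ => ?_
      rw [← Complex.sub_re, ← Complex.re_ofReal_mul]
      congr 1
      ring
  -- The volume element is itself skew-Hermitian, so the two |ψ|² terms add up, which gives the
  -- factor 2 in front of |ψ|².
  have hω : (inner ℂ (γ.e 0 (γ.e 1 (ψ i p))) (ψ m p)).re
      = -(inner ℂ (ψ i p) (γ.e 0 (γ.e 1 (ψ m p)))).re := by
    have hac : γ.e 0 (γ.e 1 (ψ m p)) = -γ.e 1 (γ.e 0 (ψ m p)) := by rw [γ.anticomm, neg_neg]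
    rw [hac, inner_neg_right, γ.skew, γ.skew]
    simp
  rw [hκ, curl_re_inner_coordMul γ hu (hψ i) (hψ m), h.re_inner_volume_dirac_left hp,
    h.re_inner_volume_dirac_right hp, hω, Real.exp_neg]
  simp only [re_inner_coordMul_left, hsum]
  field_simp
  ring

end IsKappaDiracHarmonic

end DiracHarmonic

open DiracHarmonic in
theorem mainTheorem5 {n : ℕ} (γ : CliffordMul) (Ω : Set Plane) (hΩ : IsOpen Ω)
    (u : Plane → ℝ) (hu : ContDiffOn ℝ ∞ u Ω) (κ : ℝ)
    (φ : Plane → EuclideanSpace ℝ (Fin (n + 1))) (ψ : Fin (n + 1) → Plane → Spinor)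
    (h : IsKappaDiracHarmonic γ Ω u κ φ ψ)
    (p : Plane) (hp : p ∈ Ω) (i m : Fin (n + 1)) :
    pd 0 (current γ u φ ψ 1 i m) p - pd 1 (current γ u φ ψ 0 i m) p
        - 2 * ∑ j, (current γ u φ ψ 0 i j p * current γ u φ ψ 1 j m p
            - current γ u φ ψ 1 i j p * current γ u φ ψ 0 j m p) =
      -pd 0 (fun q => (inner ℂ (coordMul γ u 1 q (ψ i q)) (ψ m q)).re) p
        + pd 1 (fun q => (inner ℂ (coordMul γ u 0 q (ψ i q)) (ψ m q)).re) p
        - 2 * ∑ j,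
            ((inner ℂ (ψ i p) (coordMul γ u 0 p (ψ j p))).re
                * (inner ℂ (ψ j p) (coordMul γ u 1 p (ψ m p))).re
              - (inner ℂ (ψ i p) (coordMul γ u 1 p (ψ j p))).re
                * (inner ℂ (ψ j p) (coordMul γ u 0 p (ψ m p))).re)
        + 4 * κ *
          (2 * (normSqSpinor ψ p : ℂ)
                * inner ℂ (ψ i p) (coordMul γ u 0 p (coordMul γ u 1 p (ψ m p)))
            + ∑ j, (inner ℂ (ψ i p) (ψ j p)
                  * inner ℂ (coordMul γ u 0 p (coordMul γ u 1 p (ψ j p))) (ψ m p)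
                - inner ℂ (ψ i p) (coordMul γ u 0 p (coordMul γ u 1 p (ψ j p)))
                  * inner ℂ (ψ j p) (ψ m p))).re := by
  have hnhds := hΩ.mem_nhds hp
  have hu' : DifferentiableAt ℝ u p := (hu.contDiffAt hnhds).differentiableAt (by simp)
  have hφ : ContDiffAt ℝ ∞ φ p := h.smooth_map.contDiffAt hnhds
  have hψ : ∀ j, DifferentiableAt ℝ (ψ j) p := fun j =>
    ((h.smooth_spinor j).contDiffAt hnhds).differentiableAt (by simp)
  have hi := contDiffAt_coord hφ i
  have hm := contDiffAt_coord hφ m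
  have hpd : ∀ α β : Fin 2, pd β (current γ u φ ψ α i m) p =
      pd β (fun q => (inner ℂ (coordMul γ u α q (ψ i q)) (ψ m q)).re) p
        + pd β (fun q => pd α (fun q => φ q i) q * φ q m - φ q i * pd α (fun q => φ q m) q) p :=
    fun α β => pd_add (differentiableAt_re_inner_coordMul γ hu' (hψ i) (hψ m) α)
      (differentiableAt_wronskian hi hm α) β
  have hskew : ∀ (α : Fin 2) (j k : Fin (n + 1)),
      (inner ℂ (ψ j p) (coordMul γ u α p (ψ k p))).re
        = -(inner ℂ (coordMul γ u α p (ψ j p)) (ψ k p)).re := by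
    intro α j k
    rw [coordMul, coordMul, ← Complex.coe_smul, ← Complex.coe_smul, inner_smul_left,
      inner_smul_right, γ.skew, Complex.conj_ofReal, mul_neg, Complex.neg_re]
  have hright : ∀ (α : Fin 2) (j : Fin (n + 1)),
      ∑ k, (inner ℂ (coordMul γ u α p (ψ j p)) (ψ k p)).re * φ p k = 0 :=
    fun α j => h.sum_re_inner_mul_eq_zero hp _
  -- The real spinorial current is skew in its two indices, so this reduces to `hright`.
  have hleft : ∀ (α : Fin 2) (j : Fin (n + 1)),
      ∑ k, φ p k * (inner ℂ (coordMul γ u α p (ψ k p)) (ψ j p)).re = 0 := by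
    intro α j
    rw [← neg_eq_zero, ← Finset.sum_neg_distrib, ← hright α j]
    refine Finset.sum_congr rfl fun k _ => ?_
    rw [← neg_eq_iff_eq_neg.2 (hskew α k j), ← inner_conj_symm, Complex.conj_re]
    ring
  have hone : ∑ j, φ p j * φ p j = 1 := by
    have hn := EuclideanSpace.real_norm_sq_eq (φ p)
    rw [mem_sphere_zero_iff_norm.1 (h.mem_sphere p hp)] at hn
    simpa [sq] using hn.symm
  have hcomm := sum_commutator (fun j => φ p j) (fun j => pd 0 (fun q => φ q j) p)
    (fun j => pd 1 (fun q => φ q j) p)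
    (fun j k => (inner ℂ (coordMul γ u 0 p (ψ j p)) (ψ k p)).re)
    (fun j k => (inner ℂ (coordMul γ u 1 p (ψ j p)) (ψ k p)).re) hone
    (sum_mul_pd_eq_zero hΩ hp hφ h.mem_sphere 0) (sum_mul_pd_eq_zero hΩ hp hφ h.mem_sphere 1)
    (hright 0) (hleft 0) (hright 1) (hleft 1) i m
  have hcurl := h.curl_spinor_current hΩ hp hu' i m
  have hw := curl_wronskian hi hm
  have hflip : ∑ j, (pd 1 (fun q => φ q j) p * (inner ℂ (coordMul γ u 0 p (ψ i p)) (ψ j p)).re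
        - pd 0 (fun q => φ q j) p * (inner ℂ (coordMul γ u 1 p (ψ i p)) (ψ j p)).re)
      = -∑ j, (pd 0 (fun q => φ q j) p * (inner ℂ (coordMul γ u 1 p (ψ i p)) (ψ j p)).re
        - pd 1 (fun q => φ q j) p * (inner ℂ (coordMul γ u 0 p (ψ i p)) (ψ j p)).re) := by
    rw [← Finset.sum_neg_distrib]
    exact Finset.sum_congr rfl fun j _ => by ring
  rw [hflip] at hcomm
  rw [hpd, hpd]
  -- Moving Clifford multiplication to the first slot changes two signs per product, so the
  -- quadratic term becomes the commutator of S.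
  simp only [hskew, neg_mul_neg]
  simp only [current]
  rw [hcomm]
  -- The coefficient 2 eliminates the mixed terms, which the commutator contributes twice and the
  -- curl of S once.
  linear_combination 2 * hcurl + hw
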